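/- **Setting.** Let $\mathbb K$ be a field of characteristic $2$. On a superspace of superdimension $(n_0|n_1+1)$ take even coordinates $q_1,\dots,q_{n_0}$ and odd coordinates $\tau,\xi_1,\dots,\xi_{n_1}$. Functions are the elements of the divided power algebra in these indeterminates, with an arbitrary shearing parameter $1\le N_i\le\infty$ for each $q_i$ and shearing parameter $1$ for the odd indeterminates (which thus square to $0$). Put $\deg\tau=2$ and $\deg q_i=\deg\xi_j=1$. Write $x_i=q_i$ for $1\le i\le n_0$, $x_{n_0+j}=\xi_j$ for $1\le j\le n_1$, $n=n_0+n_1$, and for a matrix $B\in \mathbb K^{n\times n}$ let $\alpha_B=d\tau+\sum_{i,j=1}^{n}B_{ij}x_i\,dx_j$. Two expressions for a 1-form in coordinates are called *equivalent* if the first one, written in the coordinates $\tau,x_1,\dots,x_n$, equals the second one written in some new coordinates $\tau',x_1',\dots,x_n'$, that is, in functions of the same respective parities and degrees as $\tau,x_1,\dots,x_n$ whose differentials form a basis of the module of 1-forms. The differential $d$ is odd, so $d\tau$ is even. An even 1-form $\alpha$ is *contact* (or *pericontact*) if $\alpha=0$ defines a non-integrable distribution of corank $1$ and $d\alpha$ is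 non-degenerate on its fibers. A matrix is odd if $B=\begin{pmatrix}0&C\\ D&0\end{pmatrix}$, with $C$ of size $n_0\times n_1$ and $D$ of size $n_1\times n_0$; odd bilinear forms with matrices $B,B'$ are *1-superform-equivalent* if $B=MB'M^T+A$ with $M\in GL(n_0|n_1)$ (even, invertible) and $A$ a symmetric odd supermatrix. **Theorem.** 1. On a superspace of superdimension $(k|k+1)$, i.e. $n_0=n_1=k$, all the expressions $$d\tau+\sum_{i=1}^k\xi_i\,dq_i,\qquad d\tau+\sum_{i=1}^k q_i\,d\xi_i,\qquad d\tau+\sum_{i=1}^{l}\xi_i\,dq_i+\sum_{i=l+1}^k q_i\,d\xi_i\quad(0\le l\le k)$$ are equivalent to each other. If $k\ge1$, each of them is a pericontact 1-form. If $B\in\mathbb K^{2k\times 2k}$ is such that $\alpha_B$ is pericontact, then $\alpha_B$ is equivalent to each of these expressions. 2. Let $n_0,n_1\geq 0$, let $B=\begin{pmatrix}0&C\\ D&0\end{pmatrix}$ be any odd matrix, and let $r=\operatorname{rank}(D+C^T)$. Then $B$ is 1-superform-equivalent to the odd supermatrix whose only non-zero entries form a block $1_r$ in the upper left corner of the lower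 left $n_1\times n_0$ block. Likewise, $\alpha_B$ is equivalent to $d\tau+\sum_{i=1}^r\xi_i\,dq_i$. If $n_0+n_1>0$, then $\alpha_B$ is pericontact if and only if $r=n_0=n_1$. -/

import Mathlib

set_option linter.unusedSectionVars false

open scoped Matrix

noncomputable section

namespace CharTwoForms

/-! ### Divided powers -/

section DividedPowers

variable (ι : Type) (K : Type*)

/-- Formal divided power series `∑ f r • x ^ (r)` in the indeterminates `x i`, `i : ι`, given by
the family `r ↦ f r` of their coefficients. -/
def DPSeries : Type _ := (ι →₀ ℕ) → K

variable {ι K}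

instance [Field K] : AddCommGroup (DPSeries ι K) :=
  inferInstanceAs (AddCommGroup ((ι →₀ ℕ) → K))

instance [Field K] : Module K (DPSeries ι K) :=
  inferInstanceAs (Module K ((ι →₀ ℕ) → K))

/-- The product of binomial coefficients `∏ i, (n i choose a i)`. -/
def multiChoose [Fintype ι] (n a : ι →₀ ℕ) : ℕ := ∏ i, (n i).choose (a i)

theorem multiChoose_zero [Fintype ι] (n : ι →₀ ℕ) : multiChoose n 0 = 1 := by
  simp [multiChoose]

theorem multiChoose_symm [Fintype ι] (a b : ι →₀ ℕ) :
    multiChoose (a + b) a = multiChoose (a + b) b := by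
  unfold multiChoose
  refine Finset.prod_congr rfl fun i _ => ?_
  simp only [Finsupp.add_apply]
  exact Nat.choose_symm_add

theorem multiChoose_assoc [Fintype ι] (a b c : ι →₀ ℕ) :
    multiChoose (a + b + c) (a + b) * multiChoose (a + b) a
      = multiChoose (a + (b + c)) a * multiChoose (b + c) b := by
  unfold multiChoose
  rw [← Finset.prod_mul_distrib, ← Finset.prod_mul_distrib]
  refine Finset.prod_congr rfl fun i _ => ?_
  simp only [Finsupp.add_apply]
  have h := Nat.choose_mul (n := a i + b i + c i) (k := a i + b i) (s := a i)
    (by omega)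
  rw [h]
  congr 2 <;> omega

section Ring

variable [Fintype ι] [DecidableEq ι] [Field K]

/-- `x ^ (a) * x ^ (b) = ∏ i, (a i + b i choose a i) • x ^ (a + b)`. -/
instance : Mul (DPSeries ι K) :=
  ⟨fun f g n => ∑ p ∈ Finset.HasAntidiagonal.antidiagonal n, (multiChoose n p.1 : K) * (f p.1 * g p.2)⟩

instance : One (DPSeries ι K) := ⟨fun r => if r = 0 then 1 else 0⟩

theorem DPSeries.mul_apply (f g : DPSeries ι K) (n : ι →₀ ℕ) :
    (f * g) n = ∑ p ∈ Finset.HasAntidiagonal.antidiagonal n, (multiChoose n p.1 : K) * (f p.1 * g p.2) := rfl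

theorem DPSeries.one_apply (r : ι →₀ ℕ) :
    (1 : DPSeries ι K) r = if r = 0 then 1 else 0 := rfl

theorem DPSeries.add_apply (f g : DPSeries ι K) (r : ι →₀ ℕ) : (f + g) r = f r + g r := rfl

theorem DPSeries.zero_apply (r : ι →₀ ℕ) : (0 : DPSeries ι K) r = 0 := rfl

theorem DPSeries.smul_apply (c : K) (f : DPSeries ι K) (r : ι →₀ ℕ) : (c • f) r = c * f r := rfl

theorem DPSeries.mul_comm' (f g : DPSeries ι K) : f * g = g * f := by
  funext n
  rw [DPSeries.mul_apply, DPSeries.mul_apply]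
  refine Finset.sum_nbij' Prod.swap Prod.swap ?_ ?_ (fun _ _ => rfl) (fun _ _ => rfl) ?_
  · rintro ⟨a, b⟩ hp
    rw [Finset.HasAntidiagonal.mem_antidiagonal] at hp ⊢
    rw [← hp, Prod.fst_swap, Prod.snd_swap, add_comm]
  · rintro ⟨a, b⟩ hp
    rw [Finset.HasAntidiagonal.mem_antidiagonal] at hp ⊢
    rw [← hp, Prod.fst_swap, Prod.snd_swap, add_comm]
  · rintro ⟨a, b⟩ hp
    rw [Finset.HasAntidiagonal.mem_antidiagonal] at hp
    subst hp
    rw [Prod.fst_swap, Prod.snd_swap, multiChoose_symm, mul_comm (f a)]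

theorem DPSeries.one_mul' (f : DPSeries ι K) : 1 * f = f := by
  funext n
  rw [DPSeries.mul_apply, Finset.sum_eq_single (0, n)]
  · simp [DPSeries.one_apply, multiChoose_zero]
  · rintro ⟨a, b⟩ hab hne
    rw [Finset.HasAntidiagonal.mem_antidiagonal] at hab
    have ha : a ≠ 0 := by
      rintro rfl
      apply hne
      simpa using hab
    simp [DPSeries.one_apply, ha]
  · intro h
    exact absurd (by simp [Finset.HasAntidiagonal.mem_antidiagonal]) h

theorem DPSeries.add_mul' (f g h : DPSeries ι K) : (f + g) * h = f * h + g * h := by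
  funext n
  simp only [DPSeries.mul_apply, DPSeries.add_apply, ← Finset.sum_add_distrib]
  exact Finset.sum_congr rfl fun p _ => by ring

theorem DPSeries.mul_assoc' (f g h : DPSeries ι K) : f * g * h = f * (g * h) := by
  funext n
  simp only [DPSeries.mul_apply, Finset.sum_mul, Finset.mul_sum, Finset.sum_sigma']
  refine Finset.sum_nbij' (fun x => ⟨(x.2.1, x.2.2 + x.1.2), (x.2.2, x.1.2)⟩)
    (fun x => ⟨(x.1.1 + x.2.1, x.2.2), (x.1.1, x.2.1)⟩) ?_ ?_ ?_ ?_ ?_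
  · rintro ⟨⟨u, c⟩, ⟨a, b⟩⟩ hx
    simp only [Finset.mem_sigma, Finset.HasAntidiagonal.mem_antidiagonal] at hx ⊢
    obtain ⟨h1, h2⟩ := hx
    exact ⟨by rw [← h1, ← h2, add_assoc], trivial⟩
  · rintro ⟨⟨a, u⟩, ⟨b, c⟩⟩ hx
    simp only [Finset.mem_sigma, Finset.HasAntidiagonal.mem_antidiagonal] at hx ⊢
    obtain ⟨h1, h2⟩ := hx
    exact ⟨by rw [← h1, ← h2, add_assoc], trivial⟩
  · rintro ⟨⟨u, c⟩, ⟨a, b⟩⟩ hx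
    simp only [Finset.mem_sigma, Finset.HasAntidiagonal.mem_antidiagonal] at hx
    obtain ⟨h1, h2⟩ := hx
    subst h2
    rfl
  · rintro ⟨⟨a, u⟩, ⟨b, c⟩⟩ hx
    simp only [Finset.mem_sigma, Finset.HasAntidiagonal.mem_antidiagonal] at hx
    obtain ⟨h1, h2⟩ := hx
    subst h2
    rfl
  · rintro ⟨⟨u, c⟩, ⟨a, b⟩⟩ hx
    simp only [Finset.mem_sigma, Finset.HasAntidiagonal.mem_antidiagonal] at hx
    obtain ⟨h1, h2⟩ := hx
    subst h2
    subst h1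
    have key := congrArg (Nat.cast : ℕ → K) (multiChoose_assoc a b c)
    push_cast at key
    rw [← add_assoc] at key
    simp only
    linear_combination (f a * g b * h c) * key

instance : CommRing (DPSeries ι K) :=
  { (inferInstance : AddCommGroup (DPSeries ι K)) with
    mul := (· * ·)
    one := 1
    mul_assoc := DPSeries.mul_assoc'
    mul_comm := DPSeries.mul_comm'
    one_mul := DPSeries.one_mul'
    mul_one := fun f => by rw [DPSeries.mul_comm', DPSeries.one_mul']
    left_distrib := fun f g h => by
      rw [DPSeries.mul_comm', DPSeries.add_mul', DPSeries.mul_comm' g, DPSeries.mul_comm' h]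
    right_distrib := DPSeries.add_mul'
    zero_mul := fun f => by
      funext n
      exact (Finset.sum_congr rfl fun p _ => by rw [DPSeries.zero_apply, zero_mul, mul_zero]).trans
        Finset.sum_const_zero
    mul_zero := fun f => by
      funext n
      exact (Finset.sum_congr rfl fun p _ => by rw [DPSeries.zero_apply, mul_zero, mul_zero]).trans
        Finset.sum_const_zero }

theorem DPSeries.smul_mul' (c : K) (f g : DPSeries ι K) : c • f * g = c • (f * g) := by
  funext n
  simp only [DPSeries.mul_apply, DPSeries.smul_apply, Finset.mul_sum]
  exact Finset.sum_congr rfl fun p _ => by ring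

instance : Algebra K (DPSeries ι K) :=
  Algebra.ofModule DPSeries.smul_mul'
    (fun c f g => by rw [mul_comm, DPSeries.smul_mul', mul_comm])

end Ring

/-- A shearing parameter `N = (N i)` with `1 ≤ N i ≤ ∞`. -/
structure Shearing (ι : Type) where
  ht : ι → ℕ∞
  one_le : ∀ i, 1 ≤ ht i

/-- `0 ≤ r i < 2 ^ (N i)` for all `i`, where `2 ^ ∞ = ∞`. -/
def Allowed (N : Shearing ι) (r : ι →₀ ℕ) : Prop :=
  ∀ (i : ι) (m : ℕ), N.ht i = m → r i < 2 ^ m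

theorem even_choose_of_lt {a b m : ℕ} (ha : a < 2 ^ m) (hb : b < 2 ^ m) (hab : 2 ^ m ≤ a + b) :
    2 ∣ (a + b).choose a := by
  have hm : 1 ≤ m := by
    rcases Nat.eq_zero_or_pos m with rfl | h
    · simp at ha hb hab
      omega
    · exact h
  have : Fact (Nat.Prime 2) := ⟨Nat.prime_two⟩
  apply dvd_of_one_le_padicValNat
  have hlt : Nat.log 2 (b + a) < Nat.log 2 (b + a) + m + 1 := by omega
  rw [add_comm a b, padicValNat_choose' hlt, Nat.one_le_iff_ne_zero, Ne, Finset.card_eq_zero]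
  apply Finset.ne_empty_of_mem (a := m)
  rw [Finset.mem_filter, Finset.mem_Ico]
  refine ⟨⟨hm, by omega⟩, ?_⟩
  rw [Nat.mod_eq_of_lt ha, Nat.mod_eq_of_lt hb]
  omega

theorem Allowed.add [Fintype ι] {N : Shearing ι} {a b : ι →₀ ℕ} (ha : Allowed N a)
    (hb : Allowed N b) (h : ¬ 2 ∣ multiChoose (a + b) a) : Allowed N (a + b) := by
  intro i m hi
  by_contra hlt
  apply h
  refine dvd_trans ?_ (Finset.dvd_prod_of_mem _ (Finset.mem_univ i))
  exact even_choose_of_lt (ha i m hi) (hb i m hi) (not_lt.mp hlt)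

theorem Allowed.zero (N : Shearing ι) : Allowed N 0 := by
  intro i m _
  simp

theorem Allowed.of_add {N : Shearing ι} {a b : ι →₀ ℕ} (h : Allowed N (a + b)) : Allowed N a := by
  intro i m hi
  have := h i m hi
  rw [Finsupp.add_apply] at this
  omega

theorem Allowed.single (N : Shearing ι) (i : ι) : Allowed N (Finsupp.single i 1) := by
  intro j m hj
  have h1 := N.one_le j
  rw [hj] at h1
  have hm : 1 ≤ m := by exact_mod_cast h1
  have h2 : 2 ^ 1 ≤ 2 ^ m := Nat.pow_le_pow_right (by norm_num) hm
  have h3 : Finsupp.single i 1 j ≤ 1 := by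
    classical rw [Finsupp.single_apply]
    split_ifs <;> omega
  omega

variable [Fintype ι] [DecidableEq ι] [Field K] [CharP K 2]

variable (K) in
/-- The divided power algebra with shearing parameter `N` over a field of characteristic `2`, the
span of the monomials `x ^ (r)` with `0 ≤ r i < 2 ^ (N i)`. If `N i = 1`, then `x i ^ 2 = 0`; in
characteristic `2` an odd indeterminate is an indeterminate of this sort, and the algebra is both
commutative and supercommutative. -/
def dpAlgebra (N : Shearing ι) : Subalgebra K (DPSeries ι K) where
  carrier := {f | {r | f r ≠ 0}.Finite ∧ ∀ r, f r ≠ 0 → Allowed N r}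
  mul_mem' := by
    rintro f g ⟨hf, hf'⟩ ⟨hg, hg'⟩
    have key : ∀ n, (f * g) n ≠ 0 →
        ∃ a b, f a ≠ 0 ∧ g b ≠ 0 ∧ a + b = n ∧ (multiChoose n a : K) ≠ 0 := by
      intro n hn
      rw [DPSeries.mul_apply] at hn
      obtain ⟨p, hp, hne⟩ := Finset.exists_ne_zero_of_sum_ne_zero hn
      exact ⟨p.1, p.2, left_ne_zero_of_mul (right_ne_zero_of_mul hne),
        right_ne_zero_of_mul (right_ne_zero_of_mul hne), Finset.HasAntidiagonal.mem_antidiagonal.mp hp,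
        left_ne_zero_of_mul hne⟩
    refine ⟨(hf.add hg).subset ?_, ?_⟩
    · intro n hn
      obtain ⟨a, b, ha, hb, hab, -⟩ := key n hn
      exact ⟨a, ha, b, hb, hab⟩
    · intro n hn
      obtain ⟨a, b, ha, hb, rfl, hc⟩ := key n hn
      refine (hf' a ha).add (hg' b hb) fun h2 => hc ?_
      exact (CharP.cast_eq_zero_iff K 2 _).mpr h2
  add_mem' := by
    rintro f g ⟨hf, hf'⟩ ⟨hg, hg'⟩
    have key : ∀ n, (f + g) n ≠ 0 → f n ≠ 0 ∨ g n ≠ 0 := by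
      intro n hn
      by_contra! h
      rw [DPSeries.add_apply, h.1, h.2, add_zero] at hn
      exact hn rfl
    exact ⟨(hf.union hg).subset fun n hn => key n hn,
      fun n hn => (key n hn).elim (hf' n) (hg' n)⟩
  algebraMap_mem' := by
    intro c
    have key : ∀ n, (algebraMap K (DPSeries ι K) c) n ≠ 0 → n = 0 := by
      intro n hn
      by_contra h0
      rw [Algebra.algebraMap_eq_smul_one, DPSeries.smul_apply, DPSeries.one_apply, if_neg h0,
        mul_zero] at hn
      exact hn rfl
    refine ⟨(Set.finite_singleton 0).subset fun n hn => key n hn, fun n hn => ?_⟩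
    rw [key n hn]
    exact Allowed.zero N

/-- The indeterminate `x i`. -/
def dpVar (N : Shearing ι) (i : ι) : dpAlgebra K N :=
  ⟨fun r => if r = Finsupp.single i 1 then 1 else 0, by
    have key : ∀ r, (if r = Finsupp.single i 1 then (1 : K) else 0) ≠ 0 →
        r = Finsupp.single i 1 := by
      intro r hr
      by_contra h
      exact hr (if_neg h)
    exact ⟨(Set.finite_singleton (Finsupp.single i 1)).subset fun r hr => key r hr,
      fun r hr => key r hr ▸ Allowed.single N i⟩⟩

/-- The distinguished partial derivative `∂ i`, which takes `x ^ (r)` to `x ^ (r - e i)` if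
`1 ≤ r i`, and to `0` otherwise. -/
def dpPartial (N : Shearing ι) (i : ι) : dpAlgebra K N →ₗ[K] dpAlgebra K N where
  toFun f := ⟨fun r => f.1 (r + Finsupp.single i 1), by
    obtain ⟨hf, hf'⟩ := f.2
    refine ⟨?_, fun r hr => (hf' _ hr).of_add⟩
    exact hf.preimage ((add_left_injective (Finsupp.single i 1)).injOn)⟩
  map_add' _ _ := rfl
  map_smul' _ _ := rfl

end DividedPowers

/-! ### Differential forms and vector fields -/

section Forms

variable {ι : Type} [Fintype ι] [DecidableEq ι] {K : Type*} [Field K] [CharP K 2]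
  (N : Shearing ι)

variable (K) in
/-- `1`-forms `∑ i, α i • dx i`. -/
abbrev OneForm : Type _ := ι → dpAlgebra K N

variable (K) in
/-- Vector fields `∑ i, X i • ∂ i`. -/
abbrev VField : Type _ := ι → dpAlgebra K N

variable {N}

/-- The differential `df = ∑ i, ∂ i f • dx i` of a function. -/
def dFun (f : dpAlgebra K N) : OneForm K N := fun i => dpPartial N i f

/-- The function `X f`. -/
def VField.act (X : VField K N) (f : dpAlgebra K N) : dpAlgebra K N :=
  ∑ i, X i * dpPartial N i f

/-- The bracket of vector fields. -/
def VField.bracket (X Y : VField K N) : VField K N := fun i => X.act (Y i) - Y.act (X i)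

/-- The square `X ∘ X` of an odd vector field, which is the divided square of `X` in the
characteristic `2` Lie superalgebra of vector fields. -/
def VField.square (X : VField K N) : VField K N := fun i => X.act (X i)

/-- The contraction `X ↦ α(X)` of vector fields with the `1`-form `α`. -/
def OneForm.contract (α : OneForm K N) : VField K N →ₗ[dpAlgebra K N] dpAlgebra K N :=
  Fintype.linearCombination (dpAlgebra K N) α

/-- The distribution `α = 0`. -/
def OneForm.distribution (α : OneForm K N) : Submodule (dpAlgebra K N) (VField K N) :=
  LinearMap.ker α.contract

/-- The `2`-form `dα`, as a bilinear form on vector fields; all the signs coming from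
parities are `1`. -/
def OneForm.extDeriv (α : OneForm K N) :
    VField K N →ₗ[dpAlgebra K N] VField K N →ₗ[dpAlgebra K N] dpAlgebra K N :=
  Matrix.toLinearMap₂' (dpAlgebra K N)
    (Matrix.of fun i j => dpPartial N i (α j) - dpPartial N j (α i))

/-- `f` has parity `p`, where `x i` has parity `par i`. -/
def HasParity (par : ι → ZMod 2) (f : dpAlgebra K N) (p : ZMod 2) : Prop :=
  ∀ r : ι →₀ ℕ, f.1 r ≠ 0 → ∑ i, (r i : ZMod 2) * par i = p

/-- `f` is homogeneous of degree `d`, where `x i` has degree `deg i`. -/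
def HasDegree (deg : ι → ℕ) (f : dpAlgebra K N) (d : ℕ) : Prop :=
  ∀ r : ι →₀ ℕ, f.1 r ≠ 0 → ∑ i, r i * deg i = d

/-- `X` has parity `p`. -/
def VField.HasParity (par : ι → ZMod 2) (X : VField K N) (p : ZMod 2) : Prop :=
  ∀ i, CharTwoForms.HasParity par (X i) (par i + p)

/-- `α` is even; the differential is odd, so that `dx` is even if and only if `x` is odd. -/
def OneForm.IsEven (par : ι → ZMod 2) (α : OneForm K N) : Prop :=
  ∀ i, CharTwoForms.HasParity par (α i) (par i + 1)

/-- The distribution `α = 0` is closed under the bracket and under squares of odd fields. -/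
def OneForm.IsIntegrable (par : ι → ZMod 2) (α : OneForm K N) : Prop :=
  (∀ X ∈ α.distribution, ∀ Y ∈ α.distribution, VField.bracket X Y ∈ α.distribution) ∧
    ∀ X ∈ α.distribution, X.HasParity par 1 → VField.square X ∈ α.distribution

/-- Pericontact (that is, even contact) `1`-forms: `α` is even, `α = 0` is a distribution of
corank `1`, it is not integrable, and `dα` is non-degenerate on its fibers, that is, it
restricts to a perfect pairing of the distribution with itself. The algebra of functions is local
with residue field `K`, so this is non-degeneracy at the only point. (The quadratic form
`X ↦ α (X ^ 2)` on the odd part of a fiber, which has to be considered with `dα` for an odd `α`, is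
identically `0` for an even `α`, since `α (X ^ 2)` is then an odd function.) -/
structure OneForm.IsPericontact (par : ι → ZMod 2) (α : OneForm K N) : Prop where
  even : α.IsEven par
  surjective : Function.Surjective α.contract
  nonintegrable : ¬ α.IsIntegrable par
  nondegenerate :
    (α.extDeriv.domRestrict₁₂ α.distribution α.distribution).IsPerfPair

end Forms

/-! ### The superspace with an odd coordinate `τ`, even `q i` and odd `ξ i` -/

section Superspace

/-- Labels of the coordinates on a superspace of superdimension `(n₀ | n₁ + 1)`: `none` for
the odd coordinate `τ = x₀`, `some (inl i)` for the even coordinates `q i`, and `some (inr i)` for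
the odd coordinates `ξ i`. -/
abbrev Coord (n₀ n₁ : ℕ) : Type := Option (Fin n₀ ⊕ Fin n₁)

/-- Parities of the coordinates: `τ` and `ξ i` are odd, `q i` are even. -/
def coordParity {n₀ n₁ : ℕ} : Coord n₀ n₁ → ZMod 2
  | none => 1
  | some (Sum.inl _) => 0
  | some (Sum.inr _) => 1

/-- Degrees of the coordinates: `deg τ = 2`, the other degrees are `1`. -/
def coordDegree {n₀ n₁ : ℕ} : Coord n₀ n₁ → ℕ
  | none => 2
  | some _ => 1

/-- The shearing parameter is arbitrary on the even coordinates and `1` on the odd ones. -/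
def superShearing {n₀ : ℕ} (n₁ : ℕ) (N : Shearing (Fin n₀)) : Shearing (Coord n₀ n₁) where
  ht
    | none => 1
    | some (Sum.inl i) => N.ht i
    | some (Sum.inr _) => 1
  one_le
    | none => le_rfl
    | some (Sum.inl i) => N.one_le i
    | some (Sum.inr _) => le_rfl

variable {n₀ n₁ : ℕ} {K : Type*} [Field K] [CharP K 2]

variable (K) in
/-- Functions on the superspace. -/
abbrev Fun (n₁ : ℕ) (N : Shearing (Fin n₀)) : Type _ := dpAlgebra K (superShearing n₁ N)

variable (K) in
/-- `1`-forms on the superspace. -/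
abbrev SForm (n₁ : ℕ) (N : Shearing (Fin n₀)) : Type _ := OneForm K (superShearing n₁ N)

variable {N : Shearing (Fin n₀)}

/-- A degree and parity preserving change of indeterminates: `x'` is a family of functions with
the parities and degrees of the original coordinates, and independent in the sense that the
differentials `dx' i` form a basis of the module of `1`-forms. -/
structure IsCoordinateSystem (x' : Coord n₀ n₁ → Fun K n₁ N) : Prop where
  parity : ∀ i, HasParity coordParity (x' i) (coordParity i)
  degree : ∀ i, HasDegree coordDegree (x' i) (coordDegree i)
  linearIndependent : LinearIndependent (Fun K n₁ N) fun i => dFun (x' i)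
  span_eq_top : Submodule.span (Fun K n₁ N) (Set.range fun i => dFun (x' i)) = ⊤

variable (K N) in
/-- Expressions for a `1`-form in coordinates. -/
abbrev FormExpr (n₁ : ℕ) : Type _ := (Coord n₀ n₁ → Fun K n₁ N) → SForm K n₁ N

/-- Two expressions are equivalent if `E`, written in the original coordinates `x`, is
equal to `E'`, written in some new coordinates `x'`. -/
def FormExpr.Equiv (E E' : FormExpr K N n₁) : Prop :=
  ∃ x' : Coord n₀ n₁ → Fun K n₁ N, IsCoordinateSystem x' ∧ E (dpVar _) = E' x'

/-- The expression `E`, written in the original coordinates, is a pericontact `1`-form. -/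
def FormExpr.IsPericontact (E : FormExpr K N n₁) : Prop :=
  OneForm.IsPericontact coordParity (E (dpVar _))

variable (N) in
/-- The expression `dx₀ + ∑ i j, B i j • x i • dx j`, where `x₀ = τ`. -/
def linForm (B : Matrix (Fin n₀ ⊕ Fin n₁) (Fin n₀ ⊕ Fin n₁) K) : FormExpr K N n₁ :=
  fun x => dFun (x none) + ∑ i, ∑ j, B i j • x (some i) • dFun (x (some j))

end Superspace

section Expressions

variable {k : ℕ} (K : Type*) [Field K] [CharP K 2] (N : Shearing (Fin k))

/-- `dτ + ∑ ξ i • dq i`. -/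
def exprXiDq : FormExpr K N k := fun x =>
  dFun (x none) + ∑ i : Fin k, x (some (Sum.inr i)) • dFun (x (some (Sum.inl i)))

/-- `dτ + ∑ q i • dξ i`. -/
def exprQDxi : FormExpr K N k := fun x =>
  dFun (x none) + ∑ i : Fin k, x (some (Sum.inl i)) • dFun (x (some (Sum.inr i)))

/-- `dτ + ∑ ξ i • dq i + ∑ q i • dξ i`, the first sum over the first `l` indices `i`, the second
one over the others. -/
def exprMixed (l : ℕ) : FormExpr K N k := fun x =>
  dFun (x none)
    + ∑ i : Fin k with i.val < l, x (some (Sum.inr i)) • dFun (x (some (Sum.inl i)))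
    + ∑ i : Fin k with l ≤ i.val, x (some (Sum.inl i)) • dFun (x (some (Sum.inr i)))

/-- The set of all these expressions. -/
def pericontactExprs : Set (FormExpr K N k) :=
  {exprXiDq K N, exprQDxi K N} ∪ {E | ∃ l ≤ k, E = exprMixed K N l}

end Expressions

/-! ### Odd bilinear forms -/

section Bilinear

variable {n₀ n₁ : ℕ} {K : Type*} [Field K]

/-- Even supermatrices in the standard format. -/
def IsEvenSupermatrix (M : Matrix (Fin n₀ ⊕ Fin n₁) (Fin n₀ ⊕ Fin n₁) K) : Prop :=
  M.toBlocks₁₂ = 0 ∧ M.toBlocks₂₁ = 0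

/-- Odd supermatrices in the standard format. -/
def IsOddSupermatrix (M : Matrix (Fin n₀ ⊕ Fin n₁) (Fin n₀ ⊕ Fin n₁) K) : Prop :=
  M.toBlocks₁₁ = 0 ∧ M.toBlocks₂₂ = 0

/-- `1`-superform-equivalence of odd bilinear forms: `B = M B' Mᵀ + A` with `M` in
`GL(n₀ | n₁)` and `A` a symmetric odd supermatrix. -/
def OneSuperformEquiv (B B' : Matrix (Fin n₀ ⊕ Fin n₁) (Fin n₀ ⊕ Fin n₁) K) : Prop :=
  ∃ M A : Matrix (Fin n₀ ⊕ Fin n₁) (Fin n₀ ⊕ Fin n₁) K,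
    IsUnit M ∧ IsEvenSupermatrix M ∧ IsOddSupermatrix A ∧ A.IsSymm ∧ B = M * B' * Mᵀ + A

/-- The odd supermatrix whose only non-zero entries form a block `1_r` in the upper left corner of
the lower left block. -/
def oddBlock (n₀ n₁ r : ℕ) : Matrix (Fin n₀ ⊕ Fin n₁) (Fin n₀ ⊕ Fin n₁) K :=
  Matrix.fromBlocks 0 0
    (Matrix.of fun i j => if i.val = j.val ∧ i.val < r then 1 else 0) 0

end Bilinear

end CharTwoForms

end

/-! Write an odd `B` as blocks `C`, `D` and put `E = D + Cᵀ`. The idea is that `E` carries all the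
information needed about `B`. A linear change `x' = Mᵀx` with `M = diag(P, Q)` turns `B' ↦ M B' Mᵀ`
into `E' ↦ Q E' Pᵀ`. Adding a symmetric odd `A` leaves `E` unchanged, because its two blocks
contribute `2 A₁₂ᵀ = 0`; conversely, equal `E` forces the difference of two odd matrices to be
symmetric (`oneSuperformEquiv_of_eq_mul`). The classification thus becomes that of rectangular
matrices under `GL × GL`, where rank is the only invariant (`exists_eq_mul_cornerOne_mul`).

Matrix equivalence gives equivalence of forms (`linForm_equiv_of_oneSuperformEquiv`): `M` acts on
the `x i`, and a symmetric odd `A` is absorbed into `τ`, since `∑ A i j x i dx j` is the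
differential of `∑ A i j q i ξ j`.

For the pericontact condition, the coefficient of `dτ` is `1`, so the distribution is free on the
fields `∂_k - α_k ∂_τ`, and `dα` restricted to it has the constant Gram matrix `B - Bᵀ`. That matrix
has off-diagonal blocks `Eᵀ` and `E`, hence is invertible exactly when `rank E = n₀ = n₁`. Brackets
of these fields are also governed by `B - Bᵀ`, so invertibility entails non-integrability once `n₀ +
n₁ > 0`. All the model expressions of part 1 have `E = 1`. -/

namespace CharTwoForms

/-! ### Rank normal form of a rectangular matrix -/

section RankNormalForm

variable {F : Type*} [Field F] {m n : ℕ}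

/-- The `m × n` matrix whose only non-zero entries form a block `1_r` in the upper left corner. -/
def cornerOne (F : Type*) [Field F] (m n r : ℕ) : Matrix (Fin m) (Fin n) F :=
  Matrix.of fun i j => if i.val = j.val ∧ i.val < r then 1 else 0

/-- Choose bases adapted to the map: lifts `v` of a basis `w` of the range together with a basis `u`
of the kernel in the source, and an extension of `w` to a basis in the target. The map sends `v i`
to `w i` and kills `u`. -/
theorem exists_eq_mul_cornerOne_mul (E : Matrix (Fin m) (Fin n) F) :
    ∃ (Q : Matrix (Fin m) (Fin m) F) (P : Matrix (Fin n) (Fin n) F),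
      IsUnit Q ∧ IsUnit P ∧ E = Q * cornerOne F m n E.rank * Pᵀ := by
  classical
  obtain ⟨r, hr⟩ : ∃ r, r = E.rank := ⟨_, rfl⟩
  rw [← hr]
  set f := E.mulVecLin with hf
  have hfr : Module.finrank F (LinearMap.range f) = r := hr.symm
  have hker : r + Module.finrank F (LinearMap.ker f) = n := by
    have := f.finrank_range_add_finrank_ker
    rwa [hfr, Module.finrank_fin_fun] at this
  let w := Module.finBasisOfFinrankEq F (LinearMap.range f) hfr
  let u := Module.finBasis F (LinearMap.ker f)
  have hv : ∀ i, ∃ v, f v = w i := fun i => (w i).2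
  choose v hv using hv
  have hw : LinearIndependent F fun i => (w i : Fin m → F) :=
    w.linearIndependent.map' (LinearMap.range f).subtype (Submodule.ker_subtype _)
  have hu : LinearIndependent F fun i => (u i : Fin n → F) :=
    u.linearIndependent.map' (LinearMap.ker f).subtype (Submodule.ker_subtype _)
  -- Applying `f` to a relation kills the kernel part and leaves a relation among the `w i`; what
  -- remains is then a relation among the `u i`.
  have hvu : LinearIndependent F (Sum.elim v fun i => (u i : Fin n → F)) := by
    rw [Fintype.linearIndependent_iff]
    intro g hg
    simp only [Fintype.sum_sum_type, Sum.elim_inl, Sum.elim_inr] at hg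
    have h1 : ∑ i, g (Sum.inl i) • (w i : Fin m → F) = 0 := by
      have := congrArg f hg
      simpa [map_add, map_sum, hv, LinearMap.mem_ker.mp (u _).2] using this
    have h2 := Fintype.linearIndependent_iff.mp hw (fun i => g (Sum.inl i)) h1
    simp only [h2, zero_smul, Finset.sum_const_zero, zero_add] at hg
    have h3 := Fintype.linearIndependent_iff.mp hu (fun i => g (Sum.inr i)) hg
    rintro (i | i)
    exacts [h2 i, h3 i]
  let c := Module.Basis.sumExtend hw
  have : Fintype (Fin r ⊕ Module.Basis.sumExtendIndex hw) := Module.Basis.fintypeIndexOfRankLtAleph0 c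
    (Module.rank_lt_aleph0 F _)
  have : Fintype (Module.Basis.sumExtendIndex hw) :=
    Fintype.ofInjective (Sum.inr : _ → Fin r ⊕ Module.Basis.sumExtendIndex hw) Sum.inr_injective
  have hcard : r + Fintype.card (Module.Basis.sumExtendIndex hw) = m := by
    have := Module.finrank_eq_card_basis c
    rw [Module.finrank_fin_fun] at this
    refine Eq.trans ?_ this.symm
    rw [← Nat.card_eq_fintype_card, ← Nat.card_eq_fintype_card, Nat.card_sum, Nat.card_fin]
  let em : Fin r ⊕ Module.Basis.sumExtendIndex hw ≃ Fin m :=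
    ((Equiv.refl _).sumCongr (Fintype.equivFin _)).trans
      (finSumFinEquiv.trans (finCongr hcard))
  let en : Fin r ⊕ Fin (Module.finrank F (LinearMap.ker f)) ≃ Fin n :=
    finSumFinEquiv.trans (finCongr hker)
  let Q : Matrix (Fin m) (Fin m) F := Matrix.of fun i j => c (em.symm j) i
  let R : Matrix (Fin n) (Fin n) F :=
    Matrix.of fun i j => Sum.elim v (fun i => (u i : Fin n → F)) (en.symm j) i
  have hQ : IsUnit Q := by
    rw [← Matrix.linearIndependent_cols_iff_isUnit]
    exact c.linearIndependent.comp em.symm em.symm.injective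
  have hR : IsUnit R := by
    rw [← Matrix.linearIndependent_cols_iff_isUnit]
    exact hvu.comp en.symm en.symm.injective
  have hcv : ∀ i, c (Sum.inl i) = w i := fun i => by
    simp only [c, Module.Basis.sumExtend, Module.Basis.reindex_apply, Module.Basis.extend_apply_self]
    rfl
  have key : E * R = Q * cornerOne F m n r := by
    ext i j
    have h1 : (E * R) i j = f (Sum.elim v (fun i => (u i : Fin n → F)) (en.symm j)) i := by
      simp [hf, Matrix.mul_apply, Matrix.mulVec, dotProduct, R]
    rw [h1, Matrix.mul_apply]
    obtain ⟨s, rfl⟩ := en.surjective j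
    rw [Equiv.symm_apply_apply]
    rcases s with s | s
    -- Both enumerations put the first `r` vectors first and in the same order, so `v s ↦ w s`
    -- becomes the diagonal entry `s < r`.
    · have hval : (en (Sum.inl s)).val = s.val := by simp [en]
      have hval' : (em (Sum.inl s)).val = s.val := by simp [em]
      rw [Sum.elim_inl, hv, Finset.sum_eq_single (em (Sum.inl s))]
      · simp [Q, cornerOne, hval, hval', hcv]
      · intro b _ hb
        have : b.val ≠ s.val := fun h => hb (Fin.ext (h.trans hval'.symm))
        simp [cornerOne, hval, this]
      · simp
    · have hval : r ≤ (en (Sum.inr s)).val := by simp [en]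
      rw [Sum.elim_inr, LinearMap.mem_ker.mp (u s).2, Finset.sum_eq_zero]
      · rfl
      · intro b _
        have : ¬ (b.val = (en (Sum.inr s)).val ∧ b.val < r) := by omega
        simp [cornerOne, this]
  -- From `E R = Q · corner`, the right factor `Pᵀ` must be `R⁻¹`.
  refine ⟨Q, (R⁻¹)ᵀ, hQ, ?_, ?_⟩
  · rw [Matrix.isUnit_transpose]
    exact (Matrix.isUnit_nonsing_inv_iff).mpr hR
  · rw [Matrix.transpose_transpose, ← key, Matrix.mul_assoc,
      Matrix.mul_nonsing_inv _ ((Matrix.isUnit_iff_isUnit_det _).mp hR), Matrix.mul_one]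

theorem isUnit_of_rank_eq {E : Matrix (Fin n) (Fin n) F} (h : E.rank = n) : IsUnit E := by
  rw [← Matrix.mulVec_surjective_iff_isUnit, ← Matrix.coe_mulVecLin, ← LinearMap.range_eq_top]
  apply Submodule.eq_top_of_finrank_eq
  rw [Module.finrank_fin_fun]
  exact h

end RankNormalForm

/-! ### Odd bilinear forms and the invariant `D + Cᵀ` -/

section OddForms

variable {F : Type*} [Field F] [CharP F 2] {n₀ n₁ : ℕ}

/-- Modulo symmetric odd matrices the upper right block can be moved to the lower left one, so only
`D + Cᵀ` has to be matched, and it transforms by `Q` and `Pᵀ`. -/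
theorem oneSuperformEquiv_of_eq_mul {C C' : Matrix (Fin n₀) (Fin n₁) F}
    {D D' : Matrix (Fin n₁) (Fin n₀) F} {Q : Matrix (Fin n₁) (Fin n₁) F}
    {P : Matrix (Fin n₀) (Fin n₀) F} (hQ : IsUnit Q) (hP : IsUnit P)
    (h : D + Cᵀ = Q * (D' + C'ᵀ) * Pᵀ) :
    OneSuperformEquiv (Matrix.fromBlocks 0 C D 0) (Matrix.fromBlocks 0 C' D' 0) := by
  -- With `M = diag(P, Q)` the upper right block dictates `A`; the lower left block is then correct
  -- by `h`, up to a multiple of `2`.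
  refine ⟨Matrix.fromBlocks P 0 0 Q, Matrix.fromBlocks 0 (C - P * C' * Qᵀ)
    (C - P * C' * Qᵀ)ᵀ 0, ?_, ⟨by simp, by simp⟩, ⟨by simp, by simp⟩, ?_, ?_⟩
  · rw [Matrix.isUnit_iff_isUnit_det, Matrix.det_fromBlocks_zero₂₁]
    exact ((Matrix.isUnit_iff_isUnit_det _).mp hP).mul ((Matrix.isUnit_iff_isUnit_det _).mp hQ)
  · simp [Matrix.IsSymm, Matrix.fromBlocks_transpose]
  · simp only [Matrix.fromBlocks_transpose, Matrix.fromBlocks_multiply, Matrix.fromBlocks_add]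
    have hD : D = Q * D' * Pᵀ + (C - P * C' * Qᵀ)ᵀ := by
      rw [Matrix.mul_add, Matrix.add_mul] at h
      have ht : (P * C' * Qᵀ)ᵀ = Q * C'ᵀ * Pᵀ := by
        simp [Matrix.transpose_mul, Matrix.mul_assoc]
      rw [Matrix.transpose_sub, ht]
      ext i j
      have h2 : (2 : F) = 0 := CharTwo.two_eq_zero
      have hij := congrFun (congrFun h i) j
      simp only [Matrix.add_apply, Matrix.sub_apply] at hij ⊢
      linear_combination hij + ((Q * C'ᵀ * Pᵀ) i j - Cᵀ i j) * h2
    simp only [Matrix.zero_mul, Matrix.mul_zero, zero_add, add_zero, Matrix.transpose_zero, ← hD,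
      add_sub_cancel]

theorem oneSuperformEquiv_oddBlock (C : Matrix (Fin n₀) (Fin n₁) F)
    (D : Matrix (Fin n₁) (Fin n₀) F) :
    OneSuperformEquiv (Matrix.fromBlocks 0 C D 0) (oddBlock n₀ n₁ (D + Cᵀ).rank) := by
  obtain ⟨Q, P, hQ, hP, h⟩ := exists_eq_mul_cornerOne_mul (D + Cᵀ)
  exact oneSuperformEquiv_of_eq_mul (C' := 0) (D' := cornerOne F n₁ n₀ _) hQ hP (by simpa using h)

theorem isUnit_fromBlocks_sub_transpose_iff (C : Matrix (Fin n₀) (Fin n₁) F)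
    (D : Matrix (Fin n₁) (Fin n₀) F) :
    IsUnit (Matrix.fromBlocks 0 C D 0 - (Matrix.fromBlocks 0 C D 0)ᵀ) ↔
      (D + Cᵀ).rank = n₀ ∧ (D + Cᵀ).rank = n₁ := by
  have hB : Matrix.fromBlocks 0 C D 0 - (Matrix.fromBlocks 0 C D 0)ᵀ
      = Matrix.fromBlocks 0 (D + Cᵀ)ᵀ (D + Cᵀ) 0 := by
    rw [Matrix.fromBlocks_transpose, sub_eq_add_neg, Matrix.fromBlocks_neg,
      Matrix.fromBlocks_add]
    congr 1
    · simp
    · ext i j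
      simp [CharTwo.neg_eq, add_comm]
    · ext i j
      simp [CharTwo.neg_eq]
    · simp
  rw [hB]
  generalize D + Cᵀ = E
  constructor
  -- The diagonal blocks of `(B - Bᵀ) H = 1` provide right inverses of `Eᵀ` and of `E`, which bound
  -- the rank of `E` below by `n₀` and by `n₁`.
  · intro h
    obtain ⟨H, hH⟩ := h.exists_right_inv
    rw [← Matrix.fromBlocks_toBlocks H, Matrix.fromBlocks_multiply, ← Matrix.fromBlocks_one,
      Matrix.fromBlocks_inj] at hH
    obtain ⟨h1, -, -, h4⟩ := hH
    rw [Matrix.zero_mul, zero_add] at h1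
    rw [Matrix.zero_mul, add_zero] at h4
    refine ⟨le_antisymm E.rank_le_width ?_, le_antisymm E.rank_le_height ?_⟩
    · have := Matrix.rank_mul_le_left Eᵀ H.toBlocks₂₁
      rwa [h1, Matrix.rank_one, Fintype.card_fin, Matrix.rank_transpose] at this
    · have := Matrix.rank_mul_le_left E H.toBlocks₁₂
      rwa [h4, Matrix.rank_one, Fintype.card_fin] at this
  · rintro ⟨h0, h1⟩
    obtain rfl : n₀ = n₁ := h0.symm.trans h1
    have hE : IsUnit E := isUnit_of_rank_eq h0
    obtain ⟨H, hH⟩ := hE.exists_right_inv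
    obtain ⟨H', hH'⟩ := ((Matrix.isUnit_transpose E).mpr hE).exists_right_inv
    rw [isUnit_iff_exists_inv]
    refine ⟨Matrix.fromBlocks 0 H H' 0, ?_⟩
    simp [Matrix.fromBlocks_multiply, hH, hH']

end OddForms

/-! ### Perfect pairings and Gram matrices -/

section PerfectPairing

variable {R S : Type*} [CommRing R] [Fintype S] [DecidableEq S]

/-- Under the dot product identification of the free module with its dual, the pairing is the map `v
↦ v ᵥ* G`. -/
theorem isPerfPair_toLinearMap₂'_iff (G : Matrix S S R) :
    (Matrix.toLinearMap₂' R G).IsPerfPair ↔ IsUnit G := by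
  have key : ∀ v, Matrix.toLinearMap₂' R G v = dotProductEquiv R S (v ᵥ* G) := by
    intro v
    ext j
    simp [Matrix.toLinearMap₂'_apply']
    rfl
  have key' : ⇑(Matrix.toLinearMap₂' R G) = dotProductEquiv R S ∘ G.vecMul := by
    funext v
    exact key v
  constructor
  · intro h
    have h1 := h.bijective_left
    rw [key'] at h1
    rw [← Matrix.vecMul_surjective_iff_isUnit]
    exact (Function.Bijective.of_comp_iff' (dotProductEquiv R S).bijective _).mp h1 |>.surjective
  · intro h
    apply LinearMap.IsPerfPair.of_bijective
    rw [key']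
    exact (dotProductEquiv R S).bijective.comp
      ⟨Matrix.vecMul_injective_of_isUnit h, Matrix.vecMul_surjective_iff_isUnit.mpr h⟩

theorem isPerfPair_compl₁₂_iff {M M' : Type*} [AddCommGroup M] [Module R M] [AddCommGroup M']
    [Module R M'] (e : M' ≃ₗ[R] M) (p : M →ₗ[R] M →ₗ[R] R) :
    (p.compl₁₂ (e : M' →ₗ[R] M) (e : M' →ₗ[R] M)).IsPerfPair ↔ p.IsPerfPair := by
  refine ⟨fun h => ?_, fun _ => inferInstance⟩
  refine LinearMap.IsPerfPair.congr (p.compl₁₂ (e : M' →ₗ[R] M) (e : M' →ₗ[R] M)) e.symm e.symm p ?_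
  rfl

end PerfectPairing

/-! ### The hyperplane `α = 0` when one coefficient is `1` -/

section Kernel

variable {R S : Type*} [CommRing R] [Fintype S]

/-- The kernel of the functional `X ↦ ∑ a, X a * α a` with `α none = 1` is free. -/
def kerLinearCombinationEquiv {α : Option S → R} (hα : α none = 1) :
    (S → R) ≃ₗ[R] LinearMap.ker (Fintype.linearCombination R α) where
  toFun v := ⟨fun a => a.elim (-∑ k, v k * α (some k)) v, by
    simp [Fintype.linearCombination_apply, Fintype.sum_option, hα]⟩
  map_add' v w := by
    apply Subtype.ext
    funext a
    cases a with
    | none =>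
      change -∑ k, (v k + w k) * α (some k) = -∑ k, v k * α (some k) + -∑ k, w k * α (some k)
      simp only [add_mul, Finset.sum_add_distrib, neg_add]
    | some k => rfl
  map_smul' c v := by
    apply Subtype.ext
    funext a
    cases a with
    | none =>
      change -∑ k, c * v k * α (some k) = c * -∑ k, v k * α (some k)
      simp only [mul_assoc, Finset.mul_sum, mul_neg]
    | some k => rfl
  invFun X k := X.1 (some k)
  left_inv v := rfl
  right_inv X := by
    apply Subtype.ext
    funext a
    cases a with
    | none =>
      have h := X.2
      rw [LinearMap.mem_ker, Fintype.linearCombination_apply, Fintype.sum_option, hα] at h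
      simp only [smul_eq_mul, mul_one] at h
      exact (eq_neg_of_add_eq_zero_left h).symm
    | some k => rfl

/-- The components other than `none` are free coordinates on the kernel, and `W` does not see the
remaining one, so the Gram matrix of the restriction is the submatrix of `W`. -/
theorem isPerfPair_domRestrict_ker_iff [DecidableEq S] {α : Option S → R} (hα : α none = 1)
    {W : Matrix (Option S) (Option S) R} (hl : ∀ a, W none a = 0) (hr : ∀ a, W a none = 0) :
    ((Matrix.toLinearMap₂' R W).domRestrict₁₂ (LinearMap.ker (Fintype.linearCombination R α))
      (LinearMap.ker (Fintype.linearCombination R α))).IsPerfPair ↔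
      IsUnit (W.submatrix some some) := by
  rw [← isPerfPair_compl₁₂_iff (kerLinearCombinationEquiv hα), ← isPerfPair_toLinearMap₂'_iff]
  apply iff_of_eq
  congr 1
  refine LinearMap.ext fun v => LinearMap.ext fun w => ?_
  rw [LinearMap.compl₁₂_apply, LinearMap.domRestrict₁₂_apply, Matrix.toLinearMap₂'_apply, Matrix.toLinearMap₂'_apply]
  simp only [Fintype.sum_option, hl, hr, smul_zero, Finset.sum_const_zero, zero_add]
  rfl

end Kernel

/-! ### Derivatives, parities and degrees of linear and quadratic monomials -/

section Functions

variable {ι : Type} [Fintype ι] [DecidableEq ι] {K : Type*} [Field K] [CharP K 2]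
  {N : Shearing ι}

instance : Nontrivial (dpAlgebra K N) := by
  refine ⟨⟨0, 1, fun h => ?_⟩⟩
  have := congrFun (congrArg Subtype.val h) 0
  change (0 : K) = if (0 : ι →₀ ℕ) = 0 then 1 else 0 at this
  simp at this

theorem coe_dpVar_apply (i : ι) (r : ι →₀ ℕ) :
    (dpVar N i : dpAlgebra K N).1 r = if r = Finsupp.single i 1 then 1 else 0 := rfl

theorem dpPartial_dpVar (i j : ι) :
    dpPartial N i (dpVar N j : dpAlgebra K N) = if i = j then 1 else 0 := by
  apply Subtype.ext
  funext r
  change (if r + Finsupp.single i 1 = Finsupp.single j 1 then (1 : K) else 0) = _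
  split_ifs with h1 h2 h2
  · subst h2
    have : r = 0 := by simpa using h1
    subst this
    change _ = if (0 : ι →₀ ℕ) = 0 then (1 : K) else 0
    simp
  · exfalso
    have := DFunLike.congr_fun h1 i
    simp [Ne.symm h2] at this
  · subst h2
    have : r ≠ 0 := by
      rintro rfl
      simp at h1
    change _ = if r = 0 then (1 : K) else 0
    simp [this]
  · rfl

theorem dpPartial_smul_one (i : ι) (c : K) : dpPartial N i (c • 1 : dpAlgebra K N) = 0 := by
  rw [map_smul]
  apply Subtype.ext
  funext r
  change c * (if r + Finsupp.single i 1 = 0 then (1 : K) else 0) = 0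
  simp

theorem dpPartial_zero_or_one (i : ι) (p : Prop) [Decidable p] :
    dpPartial N i (if p then 1 else 0 : dpAlgebra K N) = 0 := by
  split_ifs
  · simpa using dpPartial_smul_one (N := N) i (1 : K)
  · exact map_zero _

/-- The monomial `x i * x j`, where `i ≠ j`. -/
noncomputable def dpVarPair (N : Shearing ι) {i j : ι} (hij : i ≠ j) : dpAlgebra K N :=
  ⟨fun r => if r = Finsupp.single i 1 + Finsupp.single j 1 then 1 else 0, by
    have key : ∀ r, (if r = Finsupp.single i 1 + Finsupp.single j 1 then (1 : K) else 0) ≠ 0 →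
        r = Finsupp.single i 1 + Finsupp.single j 1 := by
      intro r hr
      by_contra h
      exact hr (if_neg h)
    refine ⟨(Set.finite_singleton _).subset fun r hr => key r hr, fun r hr => key r hr ▸ ?_⟩
    -- As `i ≠ j`, every exponent is at most `1`; hence the monomial is allowed for every shearing
    -- parameter.
    intro k m hk
    have h1 := Allowed.single N i k m hk
    have h2 := Allowed.single N j k m hk
    rw [Finsupp.add_apply]
    by_cases hki : k = i
    · subst hki
      simpa [Finsupp.single_apply, hij.symm] using h1
    · simpa [Finsupp.single_apply, Ne.symm hki] using h2⟩

theorem dpPartial_dpVarPair (k : ι) {i j : ι} (hij : i ≠ j) :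
    dpPartial N k (dpVarPair N hij : dpAlgebra K N)
      = if k = i then dpVar N j else if k = j then dpVar N i else 0 := by
  apply Subtype.ext
  funext r
  change (if r + Finsupp.single k 1 = Finsupp.single i 1 + Finsupp.single j 1 then (1 : K) else 0)
    = _
  split_ifs with h1 h2 h3 h2 h3
  · subst h2
    rw [add_comm, add_right_inj] at h1
    simp [coe_dpVar_apply, h1]
  · subst h3
    rw [add_left_inj] at h1
    simp [coe_dpVar_apply, h1]
  · exfalso
    have := DFunLike.congr_fun h1 k
    simp [Ne.symm h2, Ne.symm h3] at this
  · subst h2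
    rw [add_comm, add_right_inj] at h1
    simp [coe_dpVar_apply, h1]
  · subst h3
    rw [add_left_inj] at h1
    simp [coe_dpVar_apply, h1]
  · rfl

variable {par : ι → ZMod 2} {deg : ι → ℕ} {p : ZMod 2} {d : ℕ}

theorem HasParity.add {f g : dpAlgebra K N} (hf : HasParity par f p) (hg : HasParity par g p) :
    HasParity par (f + g) p := by
  intro r hr
  by_cases h : f.1 r = 0
  · refine hg r fun h' => hr ?_
    change f.1 r + g.1 r = 0
    rw [h, h', add_zero]
  · exact hf r h

theorem HasParity.smul {f : dpAlgebra K N} (c : K) (hf : HasParity par f p) :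
    HasParity par (c • f) p := fun r hr => hf r fun h => hr (by
  change c * f.1 r = 0
  rw [h, mul_zero])

theorem HasParity.zero : HasParity par (0 : dpAlgebra K N) p := fun _ hr => absurd rfl hr

theorem HasParity.sum {σ : Type*} (s : Finset σ) {f : σ → dpAlgebra K N}
    (hf : ∀ i ∈ s, HasParity par (f i) p) : HasParity par (∑ i ∈ s, f i) p :=
  Finset.sum_induction f (HasParity par · p) (fun _ _ => HasParity.add) HasParity.zero hf

theorem hasParity_one : HasParity par (1 : dpAlgebra K N) 0 := by
  intro r hr
  have : r = 0 := by
    by_contra h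
    exact hr (if_neg h)
  simp [this]

theorem hasParity_dpVar (i : ι) : HasParity par (dpVar N i : dpAlgebra K N) (par i) := by
  intro r hr
  have : r = Finsupp.single i 1 := by
    by_contra h
    exact hr (if_neg h)
  subst this
  simp [Finsupp.single_apply]

theorem hasParity_dpVarPair {i j : ι} (hij : i ≠ j) :
    HasParity par (dpVarPair N hij : dpAlgebra K N) (par i + par j) := by
  intro r hr
  have : r = Finsupp.single i 1 + Finsupp.single j 1 := by
    by_contra h
    exact hr (if_neg h)
  subst this
  simp [Finsupp.single_apply, add_mul, Finset.sum_add_distrib]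

theorem HasDegree.add {f g : dpAlgebra K N} (hf : HasDegree deg f d) (hg : HasDegree deg g d) :
    HasDegree deg (f + g) d := by
  intro r hr
  by_cases h : f.1 r = 0
  · refine hg r fun h' => hr ?_
    change f.1 r + g.1 r = 0
    rw [h, h', add_zero]
  · exact hf r h

theorem HasDegree.smul {f : dpAlgebra K N} (c : K) (hf : HasDegree deg f d) :
    HasDegree deg (c • f) d := fun r hr => hf r fun h => hr (by
  change c * f.1 r = 0
  rw [h, mul_zero])

theorem HasDegree.zero : HasDegree deg (0 : dpAlgebra K N) d := fun _ hr => absurd rfl hr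

theorem HasDegree.sum {σ : Type*} (s : Finset σ) {f : σ → dpAlgebra K N}
    (hf : ∀ i ∈ s, HasDegree deg (f i) d) : HasDegree deg (∑ i ∈ s, f i) d :=
  Finset.sum_induction f (HasDegree deg · d) (fun _ _ => HasDegree.add) HasDegree.zero hf

theorem hasDegree_dpVar (i : ι) : HasDegree deg (dpVar N i : dpAlgebra K N) (deg i) := by
  intro r hr
  have : r = Finsupp.single i 1 := by
    by_contra h
    exact hr (if_neg h)
  subst this
  simp [Finsupp.single_apply]

theorem hasDegree_dpVarPair {i j : ι} (hij : i ≠ j) :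
    HasDegree deg (dpVarPair N hij : dpAlgebra K N) (deg i + deg j) := by
  intro r hr
  have : r = Finsupp.single i 1 + Finsupp.single j 1 := by
    by_contra h
    exact hr (if_neg h)
  subst this
  simp [Finsupp.single_apply, add_mul, Finset.sum_add_distrib]

end Functions

/-! ### Evenness, non-degeneracy and non-integrability of `α_B` -/

section LinearForms

variable {n₀ n₁ : ℕ} {K : Type*} [Field K] [CharP K 2] {N : Shearing (Fin n₀)}
  (B : Matrix (Fin n₀ ⊕ Fin n₁) (Fin n₀ ⊕ Fin n₁) K)

theorem linForm_apply (x : Coord n₀ n₁ → Fun K n₁ N) (c : Coord n₀ n₁) :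
    linForm N B x c = dpPartial _ c (x none)
      + ∑ i, ∑ j, B i j • (x (some i) * dpPartial _ c (x (some j))) := by
  simp only [linForm, Pi.add_apply, Finset.sum_apply, Pi.smul_apply, smul_eq_mul, dFun]

theorem linForm_dpVar_none : linForm N B (dpVar _) none = 1 := by
  simp [linForm_apply, dpPartial_dpVar]

theorem linForm_dpVar_some (k : Fin n₀ ⊕ Fin n₁) :
    linForm N B (dpVar _) (some k) = ∑ i, B i k • dpVar _ (some i) := by
  simp [linForm_apply, dpPartial_dpVar]

theorem dpPartial_linForm (a b : Coord n₀ n₁) :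
    dpPartial _ a (linForm N B (dpVar _) b)
      = match a, b with
        | some i, some j => B i j • 1
        | _, _ => 0 := by
  match a, b with
  | none, none =>
    rw [linForm_dpVar_none]
    simpa using dpPartial_smul_one (N := superShearing n₁ N) none (1 : K)
  | some i, none =>
    rw [linForm_dpVar_none]
    simpa using dpPartial_smul_one (N := superShearing n₁ N) (some i) (1 : K)
  | none, some j => simp [linForm_dpVar_some, dpPartial_dpVar]
  | some i, some j => simp [linForm_dpVar_some, dpPartial_dpVar, -Fintype.sum_sum_type]

/-- The distribution of `dx₀ + ∑ k, α k dx k` is free: a vector field in it is given by its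
components other than the one at `∂₀`. -/
noncomputable def linFormDistributionEquiv :
    (Fin n₀ ⊕ Fin n₁ → Fun K n₁ N) ≃ₗ[Fun K n₁ N] (linForm N B (dpVar _)).distribution :=
  kerLinearCombinationEquiv (linForm_dpVar_none B)

/-- The coefficients of `α_B` are linear, so `dα_B` has constant coefficients: zero in the `τ`
direction and `B - Bᵀ` in the others. Its determinant is a scalar, and a scalar is a unit among
functions exactly when it is one in `K`. -/
theorem isPerfPair_linForm_iff :
    ((linForm N B (dpVar _)).extDeriv.domRestrict₁₂ (linForm N B (dpVar _)).distribution
      (linForm N B (dpVar _)).distribution).IsPerfPair ↔ IsUnit (B - Bᵀ) := by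
  refine (isPerfPair_domRestrict_ker_iff (linForm_dpVar_none B) (fun a => ?_) fun a => ?_).trans ?_
  · simp [dpPartial_linForm]
  · simp [dpPartial_linForm]
  · have : Matrix.submatrix (Matrix.of fun a b => dpPartial (superShearing n₁ N) a
          (linForm N B (dpVar _) b) - dpPartial _ b (linForm N B (dpVar _) a)) some some
        = (algebraMap K (Fun K n₁ N)).mapMatrix (B - Bᵀ) := by
      ext1 i j
      simp [dpPartial_linForm, Algebra.algebraMap_eq_smul_one, sub_smul]
    rw [this, Matrix.isUnit_iff_isUnit_det, ← RingHom.map_det, isUnit_map_iff,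
      ← Matrix.isUnit_iff_isUnit_det]

/-- The fields `∂_i - α_i ∂_τ` and `∂_j - α_j ∂_τ` lie in the distribution, and `α` takes the
constant value `B j i - B i j` on their bracket. Squares of odd fields are not needed. -/
theorem not_isIntegrable_linForm {i j : Fin n₀ ⊕ Fin n₁} (hij : B i j ≠ B j i) :
    ¬ (linForm N B (dpVar _)).IsIntegrable coordParity := by
  rintro ⟨h, -⟩
  set e := linFormDistributionEquiv (N := N) B with he
  have hn : ∀ k, (e (Pi.single k 1)).1 none = -linForm N B (dpVar _) (some k) := fun k => by
    change -∑ l, (Pi.single k 1 : _ → Fun K n₁ N) l * linForm N B (dpVar _) (some l) = _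
    simp [Pi.single_apply]
  have hs : ∀ k l, (e (Pi.single k 1)).1 (some l) = if l = k then 1 else 0 := fun k l => by
    change (Pi.single k 1 : _ → Fun K n₁ N) l = _
    rw [Pi.single_apply]
  have hact : ∀ k l, VField.act (e (Pi.single k 1)).1 ((e (Pi.single l 1)).1 none)
      = -(B k l • 1) := fun k l => by
    simp [VField.act, Fintype.sum_option, hn, hs, dpPartial_linForm]
  have hact' : ∀ k l m, VField.act (e (Pi.single k 1)).1 ((e (Pi.single l 1)).1 (some m)) = 0 :=
    fun k l m => by simp [VField.act, hs, dpPartial_zero_or_one]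
  have := LinearMap.mem_ker.mp (h _ (e (Pi.single i 1)).2 _ (e (Pi.single j 1)).2)
  rw [OneForm.contract, Fintype.linearCombination_apply, Fintype.sum_option, linForm_dpVar_none] at this
  simp only [VField.bracket, hact, hact', sub_self, zero_mul, Finset.sum_const_zero, add_zero,
    smul_eq_mul, mul_one] at this
  rw [neg_sub_neg, ← sub_smul, ← Algebra.algebraMap_eq_smul_one, map_eq_zero, sub_eq_zero] at this
  exact hij this.symm

theorem surjective_contract_linForm :
    Function.Surjective (linForm N B (dpVar _)).contract := by
  intro f
  refine ⟨Pi.single none f, ?_⟩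
  rw [OneForm.contract, Fintype.linearCombination_apply_single, linForm_dpVar_none, smul_eq_mul,
    mul_one]

/-- The coefficient of `dx_k` is `∑ B i k x_i`, whose monomials are distinct, so evenness can be
tested on each `B i k` separately. -/
theorem isEven_linForm_iff :
    (linForm N B (dpVar _)).IsEven coordParity ↔ IsOddSupermatrix B := by
  have hB : IsOddSupermatrix B ↔ ∀ i k, B i k ≠ 0 →
      (coordParity (some i) : ZMod 2) = coordParity (some k) + 1 := by
    constructor
    · rintro ⟨h1, h2⟩ (i | i) (k | k) h
      · exact absurd (congrFun (congrFun h1 i) k) h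
      · change (0 : ZMod 2) = 1 + 1
        decide
      · change (1 : ZMod 2) = 0 + 1
        decide
      · exact absurd (congrFun (congrFun h2 i) k) h
    · intro h
      constructor
      · ext i k
        by_contra hne
        have : (0 : ZMod 2) = 0 + 1 := h _ _ hne
        revert this
        decide
      · ext i k
        by_contra hne
        have : (1 : ZMod 2) = 1 + 1 := h _ _ hne
        revert this
        decide
  rw [hB]
  constructor
  · intro h i k hik
    have h1 := h (some k) (Finsupp.single (some i) 1)
    have h2 : (linForm N B (dpVar _) (some k)).1 (Finsupp.single (some i) 1) = B i k := by
      rw [linForm_dpVar_some, AddSubmonoidClass.coe_finsetSum]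
      change (∑ l, (B l k • (dpVar (superShearing n₁ N) (some l) : Fun K n₁ N)).1)
        (Finsupp.single (some i) 1) = _
      rw [show ∀ (s : Finset (Fin n₀ ⊕ Fin n₁)) (f : Fin n₀ ⊕ Fin n₁ → DPSeries (Coord n₀ n₁) K) r,
        (∑ l ∈ s, f l) r = ∑ l ∈ s, f l r from fun s f r => Finset.sum_apply r s f]
      rw [Finset.sum_eq_single i]
      · change B i k * (if _ then (1 : K) else 0) = _
        simp
      · intro b _ hb
        change B b k * (if _ then (1 : K) else 0) = _
        rw [if_neg, mul_zero]
        intro h'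
        exact hb (Option.some_inj.mp (Finsupp.single_left_injective one_ne_zero h')).symm
      · simp
    have h3 := h1 (by rwa [h2])
    simpa [Finsupp.single_apply] using h3
  · intro h c
    cases c with
    | none =>
      rw [linForm_dpVar_none]
      have : (coordParity (none : Coord n₀ n₁) : ZMod 2) + 1 = 0 := by
        change (1 : ZMod 2) + 1 = 0
        decide
      rw [this]
      exact hasParity_one
    | some k =>
      rw [linForm_dpVar_some]
      refine HasParity.sum _ fun i _ => ?_
      by_cases hik : B i k = 0
      · rw [hik, zero_smul]
        exact HasParity.zero
      · rw [← h i k hik]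
        exact (hasParity_dpVar _).smul _

theorem isPericontact_linForm_iff (hn : 0 < n₀ + n₁) :
    (linForm N B).IsPericontact ↔ IsOddSupermatrix B ∧ IsUnit (B - Bᵀ) := by
  constructor
  · intro h
    exact ⟨(isEven_linForm_iff B).mp h.even, (isPerfPair_linForm_iff B).mp h.nondegenerate⟩
  · rintro ⟨h1, h2⟩
    refine ⟨(isEven_linForm_iff B).mpr h1, surjective_contract_linForm B, ?_,
      (isPerfPair_linForm_iff B).mpr h2⟩
    -- An invertible matrix is non-zero only if it is not empty: for `n₀ = n₁ = 0` the distribution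
    -- is zero, hence integrable.
    have hne : Nonempty (Fin n₀ ⊕ Fin n₁) := by
      rw [← Fintype.card_pos_iff]
      simpa using hn
    have h3 : B - Bᵀ ≠ 0 := h2.ne_zero
    by_contra hint
    apply h3
    ext i j
    by_contra hij
    exact not_isIntegrable_linForm B (i := i) (j := j)
      (fun h => hij (by simp [h])) hint

end LinearForms

/-! ### From matrix equivalence to changes of coordinates -/

section Equivalence

variable {n₀ n₁ : ℕ} {K : Type*} [Field K] [CharP K 2] {N : Shearing (Fin n₀)}

/-- The primitive `∑ i j, A i j • q i * ξ j` of `∑ A i j • x i • dx j` for a symmetric odd `A`. -/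
noncomputable def quadPrimitive (N : Shearing (Fin n₀))
    (A : Matrix (Fin n₀ ⊕ Fin n₁) (Fin n₀ ⊕ Fin n₁) K) : Fun K n₁ N :=
  ∑ i : Fin n₀, ∑ j : Fin n₁, A (Sum.inl i) (Sum.inr j) •
    dpVarPair (superShearing n₁ N) (i := some (Sum.inl i)) (j := some (Sum.inr j)) (by simp)

theorem dpPartial_none_quadPrimitive (A : Matrix (Fin n₀ ⊕ Fin n₁) (Fin n₀ ⊕ Fin n₁) K) :
    dpPartial (superShearing n₁ N) none (quadPrimitive N A) = 0 := by
  simp [quadPrimitive, dpPartial_dpVarPair]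

/-- Differentiating by `ξ_k` reads off column `k` of the upper right block directly; differentiating
by `q_k` reads off row `k` of it, which symmetry turns into the required column. Oddness of `A`
rules out squares, so no divided square is needed. -/
theorem dpPartial_some_quadPrimitive {A : Matrix (Fin n₀ ⊕ Fin n₁) (Fin n₀ ⊕ Fin n₁) K}
    (hA : IsOddSupermatrix A) (hs : A.IsSymm) (k : Fin n₀ ⊕ Fin n₁) :
    dpPartial (superShearing n₁ N) (some k) (quadPrimitive N A)
      = ∑ i, A i k • dpVar (superShearing n₁ N) (some i) := by
  have h1 : ∀ i j, A (Sum.inl i) (Sum.inl j) = 0 := fun i j => congrFun (congrFun hA.1 i) j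
  have h2 : ∀ i j, A (Sum.inr i) (Sum.inr j) = 0 := fun i j => congrFun (congrFun hA.2 i) j
  rcases k with k | k
  · simp [quadPrimitive, dpPartial_dpVarPair, Fintype.sum_sum_type, h1, Finset.sum_comm (γ := Fin n₀),
      fun i => hs.apply (Sum.inr i) (Sum.inl k)]
  · simp [quadPrimitive, dpPartial_dpVarPair, Fintype.sum_sum_type, h2]

/-- New indeterminates `τ + ∑ A i j q i ξ j` and `∑ i, M i a x i`. -/
noncomputable def changeOfCoords (N : Shearing (Fin n₀))
    (M A : Matrix (Fin n₀ ⊕ Fin n₁) (Fin n₀ ⊕ Fin n₁) K) : Coord n₀ n₁ → Fun K n₁ N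
  | none => dpVar _ none + quadPrimitive N A
  | some a => ∑ i, M i a • dpVar _ (some i)

theorem dpPartial_none_changeOfCoords (M A : Matrix (Fin n₀ ⊕ Fin n₁) (Fin n₀ ⊕ Fin n₁) K)
    (a : Coord n₀ n₁) :
    dpPartial (superShearing n₁ N) none (changeOfCoords N M A a) = if a = none then 1 else 0 := by
  cases a with
  | none => simp [changeOfCoords, dpPartial_none_quadPrimitive, dpPartial_dpVar]
  | some a => simp [changeOfCoords, dpPartial_dpVar]

theorem dpPartial_some_changeOfCoords_some
    (M A : Matrix (Fin n₀ ⊕ Fin n₁) (Fin n₀ ⊕ Fin n₁) K) (k a : Fin n₀ ⊕ Fin n₁) :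
    dpPartial (superShearing n₁ N) (some k) (changeOfCoords N M A (some a)) = M k a • 1 := by
  simp [changeOfCoords, dpPartial_dpVar, -Fintype.sum_sum_type]

/-- The Jacobian is block triangular with diagonal blocks `1` and `M`. Evenness of `M` preserves
parities, and each `q_i ξ_j` has the parity and degree of `τ`. -/
theorem isCoordinateSystem_changeOfCoords {M : Matrix (Fin n₀ ⊕ Fin n₁) (Fin n₀ ⊕ Fin n₁) K}
    (A : Matrix (Fin n₀ ⊕ Fin n₁) (Fin n₀ ⊕ Fin n₁) K) (hM : IsUnit M)
    (hM' : IsEvenSupermatrix M) : IsCoordinateSystem (changeOfCoords N M A) := by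
  have hM0 : ∀ i a, M i a ≠ 0 →
      (coordParity (some i : Coord n₀ n₁) : ZMod 2) = coordParity (some a : Coord n₀ n₁) := by
    rintro (i | i) (a | a) h
    · rfl
    · exact absurd (congrFun (congrFun hM'.1 i) a) h
    · exact absurd (congrFun (congrFun hM'.2 i) a) h
    · rfl
  obtain ⟨M', hMM'⟩ := hM.exists_right_inv
  have hspan : Submodule.span (Fun K n₁ N)
      (Set.range fun i => dFun (changeOfCoords N M A i)) = ⊤ := by
    set V := Submodule.span (Fun K n₁ N) (Set.range fun i => dFun (changeOfCoords N M A i)) with hV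
    have hmem : ∀ i, dFun (changeOfCoords N M A i) ∈ V := fun i =>
      Submodule.subset_span ⟨i, rfl⟩
    have hsome : ∀ k, (Pi.single (some k) 1 : SForm K n₁ N) ∈ V := by
      intro k
      -- Since `dx'_a = ∑ M c a dx_c`, the right inverse `M'` of `M` gives back `dx_k = ∑ M' a k
      -- dx'_a`.
      have : (Pi.single (some k) 1 : SForm K n₁ N)
          = ∑ a, (M' a k • (1 : Fun K n₁ N)) • dFun (changeOfCoords N M A (some a)) := by
        funext c
        rw [Finset.sum_apply]
        cases c with
        | none => simp [dFun, dpPartial_none_changeOfCoords]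
        | some c =>
          simp only [Pi.smul_apply, dFun, dpPartial_some_changeOfCoords_some, smul_eq_mul,
            smul_mul_smul_comm, mul_one, ← Finset.sum_smul]
          have h := congrFun (congrFun hMM' c) k
          rw [Matrix.mul_apply] at h
          simp only [mul_comm (M' _ _), h, Matrix.one_apply, Pi.single_apply, Option.some_inj]
          split_ifs <;> simp
      rw [this]
      exact Submodule.sum_mem _ fun a _ => V.smul_mem _ (hmem _)
    have hnone : (Pi.single none 1 : SForm K n₁ N) ∈ V := by
      have : (Pi.single none 1 : SForm K n₁ N) = dFun (changeOfCoords N M A none)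
          - ∑ k, dpPartial _ (some k) (changeOfCoords N M A none) • Pi.single (some k) 1 := by
        funext c
        rw [Pi.sub_apply, Finset.sum_apply]
        cases c with
        | none => simp [dFun, dpPartial_none_changeOfCoords]
        | some c => simp [dFun, Pi.single_apply, -Fintype.sum_sum_type]
      rw [this]
      exact V.sub_mem (hmem _) (Submodule.sum_mem _ fun k _ => V.smul_mem _ (hsome k))
    rw [eq_top_iff]
    intro α _
    have : α = ∑ c, α c • Pi.single c 1 := by
      funext c
      simp [Pi.single_apply, -Fintype.sum_option]
    rw [this]
    refine Submodule.sum_mem _ fun c _ => V.smul_mem _ ?_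
    cases c with
    | none => exact hnone
    | some k => exact hsome k
  refine ⟨?_, ?_, ?_, hspan⟩
  · rintro (_ | a)
    · refine (hasParity_dpVar _).add (HasParity.sum _ fun i _ => HasParity.sum _ fun j _ => ?_)
      exact (hasParity_dpVarPair _).smul _
    · refine HasParity.sum _ fun i _ => ?_
      by_cases h : M i a = 0
      · rw [h, zero_smul]
        exact HasParity.zero
      · rw [← hM0 i a h]
        exact (hasParity_dpVar _).smul _
  · rintro (_ | a)
    · refine (hasDegree_dpVar _).add (HasDegree.sum _ fun i _ => HasDegree.sum _ fun j _ => ?_)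
      exact (hasDegree_dpVarPair _).smul _
    · refine HasDegree.sum _ fun i _ => ?_
      exact (hasDegree_dpVar (deg := coordDegree) (some i)).smul _
  -- A spanning family with as many members as the rank of a free module is independent.
  · exact linearIndependent_of_top_le_span_of_card_eq_finrank hspan.ge
      (Module.finrank_fintype_fun_eq_card _).symm

/-- With `x' = Mᵀx` one has `x'ᵀ B' dx' = xᵀ M B' Mᵀ dx`, while `dτ' - dτ = xᵀ A dx`. -/
theorem linForm_equiv_of_oneSuperformEquiv
    {B B' : Matrix (Fin n₀ ⊕ Fin n₁) (Fin n₀ ⊕ Fin n₁) K} (h : OneSuperformEquiv B B') :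
    (linForm N B).Equiv (linForm N B') := by
  obtain ⟨M, A, hM, hM', hA, hs, rfl⟩ := h
  refine ⟨changeOfCoords N M A, isCoordinateSystem_changeOfCoords A hM hM', ?_⟩
  funext c
  cases c with
  | none =>
    rw [linForm_dpVar_none, linForm_apply]
    simp [dpPartial_none_changeOfCoords]
  | some k =>
    rw [linForm_dpVar_some, linForm_apply]
    simp only [dpPartial_some_changeOfCoords_some]
    rw [changeOfCoords, map_add, dpPartial_some_quadPrimitive hA hs, dpPartial_dpVar,
      if_neg (by simp), zero_add]
    simp only [Matrix.add_apply, add_smul, Finset.sum_add_distrib]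
    -- The `A` terms cancel against the primitive; what is left is a reordering of the triple sum
    -- expanding `M B' Mᵀ`.
    rw [add_comm, add_right_inj]
    simp only [changeOfCoords, mul_smul_comm, mul_one, Finset.smul_sum, smul_smul,
      Matrix.mul_apply, Matrix.transpose_apply, Finset.sum_mul, Finset.sum_smul]
    rw [Finset.sum_comm]
    conv_lhs => enter [2, b]; rw [Finset.sum_comm]
    rw [Finset.sum_comm]
    refine Finset.sum_congr rfl fun a _ => Finset.sum_congr rfl fun b _ =>
      Finset.sum_congr rfl fun i _ => ?_
    congr 1
    ring

end Equivalence

/-! ### The model expressions as matrices -/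

section Expressions

variable {k : ℕ} {K : Type*} [Field K] [CharP K 2] {N : Shearing (Fin k)}

/-- In the mixed expression `D` and `C` are complementary diagonal projections, so they sum to `1`.
The two pure expressions are its extreme cases `l = k` and `l = 0`. -/
theorem exists_linForm_of_mem_pericontactExprs {E : FormExpr K N k}
    (hE : E ∈ pericontactExprs K N) :
    ∃ C D : Matrix (Fin k) (Fin k) K, D + Cᵀ = 1 ∧ E = linForm N (Matrix.fromBlocks 0 C D 0) := by
  have hmixed : ∀ l, exprMixed K N l = linForm N (Matrix.fromBlocks 0
      (Matrix.diagonal fun i : Fin k => if l ≤ i.val then (1 : K) else 0)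
      (Matrix.diagonal fun i : Fin k => if i.val < l then (1 : K) else 0) 0) := by
    intro l
    funext x
    simp [exprMixed, linForm, Fintype.sum_sum_type, Matrix.diagonal_apply, Finset.sum_filter,
      ite_smul]
    abel
  have hl : ∀ l, ∃ C D : Matrix (Fin k) (Fin k) K,
      D + Cᵀ = 1 ∧ exprMixed K N l = linForm N (Matrix.fromBlocks 0 C D 0) := by
    refine fun l => ⟨_, _, ?_, hmixed l⟩
    rw [Matrix.diagonal_transpose, Matrix.diagonal_add, ← Matrix.diagonal_one]
    congr 1
    funext i
    by_cases h : i.val < l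
    · simp [h]
    · simp [h, not_lt.mp h]
  rcases hE with (rfl | rfl) | ⟨l, -, rfl⟩
  · have : exprXiDq K N = exprMixed K N k := by
      funext x
      simp [exprXiDq, exprMixed, not_le.mpr (Fin.is_lt _)]
    rw [this]
    exact hl k
  · have : exprQDxi K N = exprMixed K N 0 := by
      funext x
      simp [exprQDxi, exprMixed]
    rw [this]
    exact hl 0
  · exact hl l

end Expressions

end CharTwoForms

theorem mainTheorem7 {K : Type*} [Field K] [CharP K 2] :
    (∀ (k : ℕ) (N : CharTwoForms.Shearing (Fin k)),
      (∀ E ∈ CharTwoForms.pericontactExprs K N, ∀ E' ∈ CharTwoForms.pericontactExprs K N,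
        E.Equiv E') ∧
      (0 < k → ∀ E ∈ CharTwoForms.pericontactExprs K N, E.IsPericontact) ∧
      (∀ B : Matrix (Fin k ⊕ Fin k) (Fin k ⊕ Fin k) K,
        (CharTwoForms.linForm N B).IsPericontact →
          ∀ E ∈ CharTwoForms.pericontactExprs K N, (CharTwoForms.linForm N B).Equiv E)) ∧
    (∀ (n₀ n₁ : ℕ) (C : Matrix (Fin n₀) (Fin n₁) K) (D : Matrix (Fin n₁) (Fin n₀) K),
      CharTwoForms.OneSuperformEquiv (Matrix.fromBlocks 0 C D 0)
        (CharTwoForms.oddBlock n₀ n₁ (D + Cᵀ).rank) ∧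
      ∀ N : CharTwoForms.Shearing (Fin n₀),
        (CharTwoForms.linForm N (Matrix.fromBlocks 0 C D 0)).Equiv
          (CharTwoForms.linForm N (CharTwoForms.oddBlock n₀ n₁ (D + Cᵀ).rank)) ∧
        (0 < n₀ + n₁ →
          ((CharTwoForms.linForm N (Matrix.fromBlocks 0 C D 0)).IsPericontact ↔
            (D + Cᵀ).rank = n₀ ∧ (D + Cᵀ).rank = n₁))) := by
  have hper : ∀ (n₀ n₁ : ℕ) (C : Matrix (Fin n₀) (Fin n₁) K) (D : Matrix (Fin n₁) (Fin n₀) K)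
      (N : CharTwoForms.Shearing (Fin n₀)), 0 < n₀ + n₁ →
      ((CharTwoForms.linForm N (Matrix.fromBlocks 0 C D 0)).IsPericontact ↔
        (D + Cᵀ).rank = n₀ ∧ (D + Cᵀ).rank = n₁) := fun n₀ n₁ C D N hn => by
    rw [CharTwoForms.isPericontact_linForm_iff _ hn,
      CharTwoForms.isUnit_fromBlocks_sub_transpose_iff]
    exact and_iff_right ⟨by simp, by simp⟩
  refine ⟨fun k N => ⟨fun E hE E' hE' => ?_, fun hk E hE => ?_, fun B hB E hE => ?_⟩,
    fun n₀ n₁ C D => ⟨CharTwoForms.oneSuperformEquiv_oddBlock C D, fun N => ⟨?_, hper n₀ n₁ C D N⟩⟩⟩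
  · obtain ⟨C, D, h, rfl⟩ := CharTwoForms.exists_linForm_of_mem_pericontactExprs hE
    obtain ⟨C', D', h', rfl⟩ := CharTwoForms.exists_linForm_of_mem_pericontactExprs hE'
    exact CharTwoForms.linForm_equiv_of_oneSuperformEquiv
      (CharTwoForms.oneSuperformEquiv_of_eq_mul isUnit_one isUnit_one (by simp [h, h']))
  · obtain ⟨C, D, h, rfl⟩ := CharTwoForms.exists_linForm_of_mem_pericontactExprs hE
    rw [hper k k C D N (by omega), h, Matrix.rank_one, Fintype.card_fin]
    exact ⟨rfl, rfl⟩
  · obtain ⟨C', D', h', rfl⟩ := CharTwoForms.exists_linForm_of_mem_pericontactExprs hE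
    have hodd := (CharTwoForms.isEven_linForm_iff B).mp hB.even
    -- Non-degeneracy is used directly, since the full criterion for pericontact forms would require
    -- `k > 0`.
    have hunit := (CharTwoForms.isPerfPair_linForm_iff B).mp hB.nondegenerate
    obtain ⟨C, D, rfl⟩ : ∃ C D, B = Matrix.fromBlocks 0 C D 0 := by
      refine ⟨B.toBlocks₁₂, B.toBlocks₂₁, ?_⟩
      conv_lhs => rw [← Matrix.fromBlocks_toBlocks B, hodd.1, hodd.2]
    have hrank := ((CharTwoForms.isUnit_fromBlocks_sub_transpose_iff C D).mp hunit).1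
    have hDC : IsUnit (D + Cᵀ) := CharTwoForms.isUnit_of_rank_eq hrank
    -- The target has `D' + C'ᵀ = 1`, so the invertible `D + Cᵀ` can itself serve as `Q`, with `P =
    -- 1`.
    exact CharTwoForms.linForm_equiv_of_oneSuperformEquiv
      (CharTwoForms.oneSuperformEquiv_of_eq_mul hDC isUnit_one (by simp [h']))
  · exact CharTwoForms.linForm_equiv_of_oneSuperformEquiv
      (CharTwoForms.oneSuperformEquiv_oddBlock C D)
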